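/- Let $H$ be a complex Hilbert space with inner product $\langle\cdot,\cdot\rangle$ and let $A$ be a non-zero bounded positive semidefinite operator on $H$; the range $R(A)$ is not assumed to be closed. Let $B_{A^{1/2}}(H)$ be the set of all bounded operators $T$ on $H$ with $R(T^*A^{1/2})\subseteq R(A^{1/2})$. Put $\|\xi\|_A=\langle A\xi,\xi\rangle^{1/2}$ for $\xi\in H$ and $\|T\|_A=\sup\{\|T\xi\|_A/\|\xi\|_A : 0\neq\xi\in\overline{R(A)}\}$. For $T\in B_{A^{1/2}}(H)$ let $r_A(T)=\lim_{n\to\infty}\|T^n\|_A^{1/n}$ be the $A$-spectral radius, and let $T^\diamond$ be the unique bounded operator on $H$ with $T^*A^{1/2}=A^{1/2}T^\diamond$ and $R(T^\diamond)\subseteq\overline{R(A^{1/2})}$. A non-zero $T\in B_{A^{1/2}}(H)$ is called $A$-invertible if there is a non-zero $S\in B_{A^{1/2}}(H)$ with $ATS=AST=A$, and $\sigma_A(T)$ is the set of all $\lambda\in\mathbb{C}$ for which $\lambda-T$ is not $A$-invertible. Then, for every $T\in B_{A^{1/2}}(H)$, the operator $T^\diamond$ also belongs to $B_{A^{1/2}}(H)$,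 the limits defining $r_A(T)$ and $r_A(T^\diamond)$ exist, the set $\sigma_A(T)$ is non-empty and bounded, and $$\sup\{|\lambda| : \lambda\in\sigma_A(T)\}=\frac{r_A(T)+r_A(T^\diamond)+|r_A(T^\diamond)-r_A(T)|}{2}=\max\{r_A(T),r_A(T^\diamond)\}.$$ -/

import Mathlib

open Filter Topology

noncomputable section

namespace SemiHilbert

variable {H : Type*} [NormedAddCommGroup H] [InnerProductSpace ℂ H] [CompleteSpace H]

/-- The seminorm `‖ξ‖_A = ⟨Aξ, ξ⟩^{1/2}` induced by a positive semidefinite operator `A`. -/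
def seminormA (A : H →L[ℂ] H) (ξ : H) : ℝ :=
  √(RCLike.re (inner ℂ (A ξ) ξ))

/-- `‖T‖_A`, the supremum of `‖Tξ‖_A / ‖ξ‖_A` over the nonzero `ξ` in the closure of `R(A)`. -/
def opNormA (A T : H →L[ℂ] H) : ℝ :=
  sSup {c : ℝ | ∃ ξ : H, ξ ∈ closure (Set.range A) ∧ ξ ≠ 0 ∧
    c = seminormA A (T ξ) / seminormA A ξ}

/-- The positive square root `A^{1/2}` of a positive semidefinite operator `A`. -/
def sqrtA (A : H →L[ℂ] H) : H →L[ℂ] H := CFC.sqrt A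

/-- The set `B_{A^{1/2}}(H)` of all `T ∈ B(H)` with `R(T* A^{1/2}) ⊆ R(A^{1/2})`. -/
def BHalf (A : H →L[ℂ] H) : Set (H →L[ℂ] H) :=
  {T | Set.range (ContinuousLinearMap.adjoint T ∘L sqrtA A) ⊆ Set.range (sqrtA A)}

/-- The positive square root is self-adjoint. -/
theorem inner_sqrt (A : H →L[ℂ] H) (x y : H) :
    inner ℂ (sqrtA A x) y = inner ℂ x (sqrtA A y) := by
  have h : IsSelfAdjoint (sqrtA A) := (CFC.sqrt_nonneg A).isSelfAdjoint
  exact h.isSymmetric x y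

/-- `A^{1/2}` is injective on the closure of its range. -/
theorem eq_zero_of_sqrt_eq_zero (A : H →L[ℂ] H) {y : H}
    (hy : y ∈ closure (Set.range (sqrtA A))) (h0 : sqrtA A y = 0) : y = 0 := by
  have hcl : IsClosed {z : H | inner ℂ z y = 0} :=
    isClosed_eq (by fun_prop) continuous_const
  have hsub : Set.range (sqrtA A) ⊆ {z : H | inner ℂ z y = 0} := by
    rintro _ ⟨x, rfl⟩
    simp [inner_sqrt, h0]
  have : inner ℂ y y = 0 := closure_minimal hsub hcl hy
  exact inner_self_eq_zero.mp this

/-- Every `A^{1/2} x` has a preimage under `A^{1/2}` in the closure of `R(A^{1/2})`. -/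
theorem exists_preimage (A : H →L[ℂ] H) (x : H) :
    ∃ y ∈ closure (Set.range (sqrtA A)), sqrtA A y = sqrtA A x := by
  set K : Submodule ℂ H := (LinearMap.range (sqrtA A).toLinearMap).topologicalClosure with hK
  have hKc : (K : Set H) = closure (Set.range (sqrtA A)) := by
    rw [hK, Submodule.topologicalClosure_coe]
    rfl
  have : CompleteSpace K :=
    (Submodule.isClosed_topologicalClosure _).completeSpace_coe
  refine ⟨K.starProjection x, ?_, ?_⟩
  · rw [← hKc]
    exact Submodule.starProjection_apply_mem K x
  · have horth : x - K.starProjection x ∈ Kᗮ := Submodule.sub_starProjection_mem_orthogonal x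
    have hz : sqrtA A (x - K.starProjection x) = 0 := by
      rw [← inner_self_eq_zero (𝕜 := ℂ), inner_sqrt, ← inner_conj_symm]
      have hm : sqrtA A (sqrtA A (x - K.starProjection x)) ∈ K :=
        Submodule.le_topologicalClosure _ ⟨_, rfl⟩
      rw [(Submodule.mem_orthogonal K _).mp horth _ hm]
      simp
    rw [map_sub, sub_eq_zero] at hz
    exact hz.symm

/-- `D` is the reduced solution of `T* A^{1/2} = A^{1/2} X`. -/
def IsReducedSolution (A T D : H →L[ℂ] H) : Prop :=
  ContinuousLinearMap.adjoint T ∘L sqrtA A = sqrtA A ∘L D ∧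
    Set.range D ⊆ closure (Set.range (sqrtA A))

/-- Existence and uniqueness of the reduced solution, for `T ∈ B_{A^{1/2}}(H)`. -/
theorem existsUnique_reducedSolution {A T : H →L[ℂ] H} (hT : T ∈ BHalf A) :
    ∃! D : H →L[ℂ] H, IsReducedSolution A T D := by
  set E := sqrtA A with hE
  have hadd : ∀ {y z : H}, y ∈ closure (Set.range E) → z ∈ closure (Set.range E) → ∀ c : ℂ,
      y + c • z ∈ closure (Set.range E) := by
    intro y z hy hz c
    have hc : closure (Set.range E) =
        ((LinearMap.range E.toLinearMap).topologicalClosure : Set H) := by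
      rw [Submodule.topologicalClosure_coe]
      rfl
    rw [hc] at *
    exact Submodule.add_mem _ hy (Submodule.smul_mem _ c hz)
  have hinj : ∀ {y z : H}, y ∈ closure (Set.range E) → z ∈ closure (Set.range E) →
      E y = E z → y = z := by
    intro y z hy hz h
    have h1 := eq_zero_of_sqrt_eq_zero A (hadd hy hz (-1)) (by
      rw [← hE, map_add, map_smul, h]
      simp)
    have h2 : y - z = 0 := by simpa [sub_eq_add_neg] using h1
    exact sub_eq_zero.mp h2
  have hex : ∀ x : H, ∃ y ∈ closure (Set.range E), E y = ContinuousLinearMap.adjoint T (E x) := by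
    intro x
    obtain ⟨w, hw⟩ := hT ⟨x, rfl⟩
    obtain ⟨y, hy, hyw⟩ := exists_preimage A w
    exact ⟨y, hy, hyw.trans hw⟩
  choose f hf hEf using hex
  let L : H →ₗ[ℂ] H :=
    { toFun := f
      map_add' := fun x y => hinj (hf _) (by simpa using hadd (hf x) (hf y) 1) (by simp [hEf])
      map_smul' := fun c x => by
        have h0 : f 0 = 0 := by
          apply eq_zero_of_sqrt_eq_zero A (hf 0)
          rw [← hE, hEf]
          simp
        have h00 : f 0 + c • f x = c • f x := by rw [h0, zero_add]
        refine hinj (hf _) ?_ (by simp [hEf])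
        have := hadd (hf 0) (hf x) c
        rw [h00] at this
        exact this }
  have hL : Continuous L := by
    apply L.continuous_of_seq_closed_graph
    intro u x y hu hLu
    have hy : y ∈ closure (Set.range E) :=
      isClosed_closure.mem_of_tendsto hLu (Eventually.of_forall fun n => hf (u n))
    refine hinj hy (hf x) ?_
    have h1 : Tendsto (fun n => E (f (u n))) atTop (𝓝 (E y)) := (E.continuous.tendsto y).comp hLu
    have h2 : Tendsto (fun n => E (f (u n))) atTop (𝓝 (E (f x))) := by
      simp only [hEf]
      exact (((ContinuousLinearMap.adjoint T).continuous.comp E.continuous).tendsto x).comp hu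
    exact tendsto_nhds_unique h1 h2
  refine ⟨⟨L, hL⟩, ⟨?_, ?_⟩, ?_⟩
  · ext x
    exact (hEf x).symm
  · rintro _ ⟨x, rfl⟩
    exact hf x
  · rintro D ⟨hD, hDr⟩
    ext x
    refine hinj (hDr ⟨x, rfl⟩) (hf x) ?_
    refine Eq.trans ?_ (hEf x).symm
    exact (congrArg (fun G : H →L[ℂ] H => G x) hD).symm

/-- `T^◇`, the unique reduced solution of `T* A^{1/2} = A^{1/2} X`. -/
def diamond {A T : H →L[ℂ] H} (hT : T ∈ BHalf A) : H →L[ℂ] H :=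
  (existsUnique_reducedSolution hT).choose

theorem diamond_spec {A T : H →L[ℂ] H} (hT : T ∈ BHalf A) :
    IsReducedSolution A T (diamond hT) :=
  (existsUnique_reducedSolution hT).choose_spec.1

/-- `T` is `A`-invertible in `B_{A^{1/2}}(H)`. -/
def IsInvertibleA (A T : H →L[ℂ] H) : Prop :=
  T ∈ BHalf A ∧ T ≠ 0 ∧
    ∃ S ∈ BHalf A, S ≠ 0 ∧ A ∘L T ∘L S = A ∧ A ∘L S ∘L T = A

/-- The `A`-resolvent set `ρ_A(T)`. -/
def resolventSetA (A T : H →L[ℂ] H) : Set ℂ :=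
  {μ : ℂ | IsInvertibleA A (μ • ContinuousLinearMap.id ℂ H - T)}

/-- The `A`-spectrum `σ_A(T)`. -/
def spectrumA (A T : H →L[ℂ] H) : Set ℂ :=
  (resolventSetA A T)ᶜ

/-- The sequence `‖T^n‖_A^{1/n}`. -/
def rootSeqA (A T : H →L[ℂ] H) (n : ℕ) : ℝ :=
  opNormA A (T ^ n) ^ (1 / (n : ℝ))

/-- The `A`-spectral radius `r_A(T)`, the limit of `‖T^n‖_A^{1/n}`. -/
def spectralRadiusA (A T : H →L[ℂ] H) : ℝ :=
  limUnder atTop (rootSeqA A T)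

end SemiHilbert

end

/-! Let `K` be the closure of the range of `A^{1/2}`. Membership of `T` in `BHalf A` means `S
A^{1/2} = A^{1/2} T` for some bounded `S` (`mem_BHalf_iff`). The compressions of `T` and `S` to `K`
form a pair in the Banach algebra `intertwiners (sqrtEnd A)`. Every such pair arises this way and is
determined by its first component, so `A`-invertibility is invertibility of the pair and `σ_A(T)` is
its spectrum (`spectrumA_eq_spectrum`). The algebra carries the max norm, so Gelfand's formula gives
the larger of the two component spectral radii. These are the required radii: `‖T^n‖_A` is the norm
of the `n`-th power of the compression of `S`, while for `T^◇` the role of `S` is played by `T*`,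
whose compression is adjoint to that of `T`. -/

noncomputable section

namespace SemiHilbert

/-! ### Spectral radii in a Banach algebra of intertwined pairs -/

section BanachAlgebra

variable {R : Type*} [NormedRing R] [NormedAlgebra ℂ R] [CompleteSpace R]

/-- The spectral radius of an element of a complex Banach algebra, as a real number. -/
def realSpectralRadius (a : R) : ℝ := (spectralRadius ℂ a).toReal

theorem spectralRadius_ne_top [Nontrivial R] (a : R) : spectralRadius ℂ a ≠ ⊤ := by
  obtain ⟨z, -, hz⟩ := spectrum.exists_nnnorm_eq_spectralRadius a
  exact hz ▸ ENNReal.coe_ne_top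

/-- Gelfand's formula, in the reals. -/
theorem tendsto_realSpectralRadius [Nontrivial R] (a : R) :
    Tendsto (fun n : ℕ => ‖a ^ n‖ ^ (1 / (n : ℝ))) atTop (𝓝 (realSpectralRadius a)) := by
  have h := (ENNReal.tendsto_toReal (spectralRadius_ne_top a)).comp
    (spectrum.pow_norm_pow_one_div_tendsto_nhds_spectralRadius a)
  refine h.congr fun n => ?_
  exact ENNReal.toReal_ofReal (by positivity)

theorem isGreatest_norm_spectrum [Nontrivial R] (a : R) :
    IsGreatest {r : ℝ | ∃ μ ∈ spectrum ℂ a, r = ‖μ‖} (realSpectralRadius a) := by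
  constructor
  · obtain ⟨z, hz, h⟩ := spectrum.exists_nnnorm_eq_spectralRadius a
    exact ⟨z, hz, by simp [realSpectralRadius, ← h]⟩
  · rintro _ ⟨μ, hμ, rfl⟩
    have h : (‖μ‖₊ : ENNReal) ≤ spectralRadius ℂ a :=
      le_iSup₂ (f := fun (k : ℂ) (_ : k ∈ spectrum ℂ a) => (‖k‖₊ : ENNReal)) μ hμ
    simpa [realSpectralRadius] using ENNReal.toReal_mono (spectralRadius_ne_top a) h

/-- The Banach algebra of all pairs `(x, y)` with `a x = y a`. -/
def intertwiners (a : R) : Subalgebra ℂ (R × R) where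
  carrier := {p | a * p.1 = p.2 * a}
  mul_mem' {p q} (hp : a * p.1 = p.2 * a) (hq : a * q.1 = q.2 * a) := by
    change a * (p.1 * q.1) = p.2 * q.2 * a
    rw [← mul_assoc, hp, mul_assoc, hq, mul_assoc]
  add_mem' {p q} (hp : a * p.1 = p.2 * a) (hq : a * q.1 = q.2 * a) := by
    change a * (p.1 + q.1) = (p.2 + q.2) * a
    rw [mul_add, add_mul, hp, hq]
  algebraMap_mem' c := (Algebra.commutes c a).symm

instance (a : R) : CompleteSpace (intertwiners a) := by
  have h : IsClosed {p : R × R | a * p.1 = p.2 * a} := isClosed_eq (by fun_prop) (by fun_prop)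
  exact h.completeSpace_coe

/-- The largest modulus of a spectral value of a pair of intertwined elements is the larger one of
the spectral radii of the two components. -/
theorem isGreatest_norm_spectrum_intertwiners [Nontrivial R] {a : R} (p : intertwiners a) :
    IsGreatest {r : ℝ | ∃ μ ∈ spectrum ℂ p, r = ‖μ‖}
      (max (realSpectralRadius p.1.1) (realSpectralRadius p.1.2)) := by
  convert isGreatest_norm_spectrum p
  -- Gelfand's formula for the pair: the product norm is a maximum, and the monotone map `x ↦
  -- x^(1/n)` commutes with `max`.
  refine Eq.symm (tendsto_nhds_unique (tendsto_realSpectralRadius p)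
    (((tendsto_realSpectralRadius _).max (tendsto_realSpectralRadius _)).congr fun n => ?_))
  have hn : ‖p ^ n‖ = max ‖p.1.1 ^ n‖ ‖p.1.2 ^ n‖ := rfl
  have hmono : MonotoneOn (fun x : ℝ => x ^ (1 / (n : ℝ))) (Set.Ici 0) :=
    Real.monotoneOn_rpow_Ici_of_exponent_nonneg (by positivity)
  rw [hn]
  exact (hmono.map_max (norm_nonneg _) (norm_nonneg _)).symm

end BanachAlgebra

/-! ### The closed range of the square root -/

variable {H : Type*} [NormedAddCommGroup H] [InnerProductSpace ℂ H] [CompleteSpace H]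

/-- The closure of the range of `A^{1/2}`. -/
def closedRange (A : H →L[ℂ] H) : Submodule ℂ H :=
  (LinearMap.range (sqrtA A).toLinearMap).topologicalClosure

instance (A : H →L[ℂ] H) : CompleteSpace (closedRange A) :=
  (Submodule.isClosed_topologicalClosure _).completeSpace_coe

theorem coe_closedRange (A : H →L[ℂ] H) :
    (closedRange A : Set H) = closure (Set.range (sqrtA A)) :=
  Submodule.topologicalClosure_coe _

theorem sqrtA_mem_closedRange (A : H →L[ℂ] H) (x : H) : sqrtA A x ∈ closedRange A :=
  Submodule.le_topologicalClosure _ ⟨x, rfl⟩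

/-- The orthogonal projection of `H` onto the closure of the range of `A^{1/2}`. -/
def proj (A : H →L[ℂ] H) : H →L[ℂ] closedRange A := (closedRange A).orthogonalProjectionOnto

/-- `A^{1/2}` as a map into the closure of its range. -/
def sqrtCod (A : H →L[ℂ] H) : H →L[ℂ] closedRange A :=
  (sqrtA A).codRestrict (closedRange A) (sqrtA_mem_closedRange A)

@[simp]
theorem coe_sqrtCod (A : H →L[ℂ] H) (x : H) : (sqrtCod A x : H) = sqrtA A x := rfl

@[simp]
theorem proj_coe (A : H →L[ℂ] H) (k : closedRange A) : proj A k = k :=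
  Submodule.orthogonalProjectionOnto_mem_subspace_eq_self k

@[simp]
theorem sqrtA_proj (A : H →L[ℂ] H) (x : H) : sqrtA A (proj A x) = sqrtA A x := by
  rw [eq_comm, ← sub_eq_zero, ← map_sub, ← inner_self_eq_zero (𝕜 := ℂ), inner_sqrt]
  exact (Submodule.mem_orthogonal' _ _).mp
    (Submodule.sub_starProjection_mem_orthogonal (K := closedRange A) x) _
      (sqrtA_mem_closedRange A _)

@[simp]
theorem sqrtCod_proj (A : H →L[ℂ] H) (x : H) : sqrtCod A (proj A x) = sqrtCod A x :=
  Subtype.ext (sqrtA_proj A x)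

theorem proj_eq_of_sqrtA_eq {A : H →L[ℂ] H} {x y : H} (h : sqrtA A x = sqrtA A y) :
    proj A x = proj A y := by
  rw [← sub_eq_zero, ← map_sub]
  refine Subtype.ext (eq_zero_of_sqrt_eq_zero A ?_ ?_)
  · rw [← coe_closedRange]
    exact (proj A (x - y)).2
  · rw [sqrtA_proj, map_sub, h, sub_self]

theorem denseRange_sqrtCod (A : H →L[ℂ] H) : DenseRange (sqrtCod A) := by
  intro k
  have hk : (k : H) ∈ closure (Set.range (sqrtA A)) := by
    rw [← coe_closedRange]
    exact k.2
  rw [closure_subtype, ← Set.range_comp]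
  exact hk

theorem sqrtA_comp_sqrtA {A : H →L[ℂ] H} (hA : A.IsPositive) : sqrtA A ∘L sqrtA A = A :=
  CFC.sqrt_mul_sqrt_self A ((ContinuousLinearMap.nonneg_iff_isPositive A).mpr hA)

theorem sqrtA_sqrtA {A : H →L[ℂ] H} (hA : A.IsPositive) (x : H) :
    sqrtA A (sqrtA A x) = A x :=
  congrArg (fun B : H →L[ℂ] H => B x) (sqrtA_comp_sqrtA hA)

theorem adjoint_sqrtA (A : H →L[ℂ] H) : ContinuousLinearMap.adjoint (sqrtA A) = sqrtA A :=
  (CFC.sqrt_nonneg A).isSelfAdjoint.adjoint_eq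

theorem sqrtA_eq_of_apply_eq {A : H →L[ℂ] H} (hA : A.IsPositive) {x y : H} (h : A x = A y) :
    sqrtA A x = sqrtA A y := by
  rw [← sub_eq_zero, ← map_sub, ← inner_self_eq_zero (𝕜 := ℂ), inner_sqrt, sqrtA_sqrtA hA,
    map_sub, h, sub_self, inner_zero_right]

theorem seminormA_eq_norm {A : H →L[ℂ] H} (hA : A.IsPositive) (x : H) :
    seminormA A x = ‖sqrtA A x‖ := by
  rw [seminormA, ← sqrtA_sqrtA hA, inner_sqrt, inner_self_eq_norm_sq, Real.sqrt_sq (norm_nonneg _)]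

/-- This matches the domain of the supremum in `opNormA` with `closedRange A`. Preimages under
`A^{1/2}` can be chosen in the closed range, hence approximated by vectors `A^{1/2} z`. -/
theorem closure_range_eq {A : H →L[ℂ] H} (hA : A.IsPositive) :
    closure (Set.range A) = closedRange A := by
  rw [coe_closedRange]
  apply (closure_minimal _ isClosed_closure).antisymm (closure_minimal _ isClosed_closure)
  · rintro _ ⟨x, rfl⟩
    exact subset_closure ⟨sqrtA A x, sqrtA_sqrtA hA x⟩
  · rintro _ ⟨x, rfl⟩
    obtain ⟨y, hy, hyx⟩ := exists_preimage A x
    rw [← hyx]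
    refine map_mem_closure (sqrtA A).continuous hy ?_
    rintro _ ⟨z, rfl⟩
    exact ⟨z, (sqrtA_sqrtA hA z).symm⟩

/-! ### Compressions and the `A`-norm -/

/-- The compression of an operator to the closure of the range of `A^{1/2}`. -/
def compress (A S : H →L[ℂ] H) : closedRange A →L[ℂ] closedRange A :=
  proj A ∘L S ∘L (closedRange A).subtypeL

theorem compress_apply (A S : H →L[ℂ] H) (k : closedRange A) : compress A S k = proj A (S k) := rfl

theorem adjoint_compress (A S : H →L[ℂ] H) :
    ContinuousLinearMap.adjoint (compress A S) = compress A (ContinuousLinearMap.adjoint S) := by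
  have h : ∀ (R : H →L[ℂ] H) (x y : closedRange A),
      inner ℂ (compress A R x) y = inner ℂ (R x) (y : H) := fun R x y =>
    Submodule.inner_orthogonalProjectionOnto_eq_of_mem_right y (R x)
  refine ContinuousLinearMap.ext fun k => ext_inner_right ℂ fun l => ?_
  rw [ContinuousLinearMap.adjoint_inner_left, h, ContinuousLinearMap.adjoint_inner_left,
    ← inner_conj_symm, h, inner_conj_symm]

theorem sqrtCod_apply_of_intertwine {A S R : H →L[ℂ] H} (h : S ∘L sqrtA A = sqrtA A ∘L R) (x : H) :
    sqrtCod A (R x) = compress A S (sqrtCod A x) := by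
  have hx : S (sqrtA A x) = sqrtA A (R x) := congrArg (fun B : H →L[ℂ] H => B x) h
  rw [compress_apply, coe_sqrtCod, hx, ← coe_sqrtCod, proj_coe]

/-- Take adjoints: `S` is the adjoint of the reduced solution, and conversely `S* x` supplies the
required preimage. -/
theorem mem_BHalf_iff {A T : H →L[ℂ] H} :
    T ∈ BHalf A ↔ ∃ S : H →L[ℂ] H, S ∘L sqrtA A = sqrtA A ∘L T := by
  constructor
  · intro hT
    refine ⟨ContinuousLinearMap.adjoint (diamond hT), ?_⟩
    have h := congrArg ContinuousLinearMap.adjoint (diamond_spec hT).1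
    simpa [ContinuousLinearMap.adjoint_comp, adjoint_sqrtA] using h.symm
  · rintro ⟨S, hS⟩
    have h := congrArg ContinuousLinearMap.adjoint hS
    simp only [ContinuousLinearMap.adjoint_comp, adjoint_sqrtA] at h
    rintro _ ⟨x, rfl⟩
    exact ⟨ContinuousLinearMap.adjoint S x, congrArg (fun B : H →L[ℂ] H => B x) h⟩

/-- If `A^{1/2} R = Y A^{1/2}`, then `‖R‖_A` is the operator norm of `Y` on the closure of the
range of `A^{1/2}`. -/
theorem opNormA_eq_norm {A R : H →L[ℂ] H} (hA : A.IsPositive)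
    {Y : closedRange A →L[ℂ] closedRange A} (h : ∀ x, sqrtCod A (R x) = Y (sqrtCod A x)) :
    opNormA A R = ‖Y‖ := by
  have hY : ∀ x, seminormA A (R x) / seminormA A x = ‖Y (sqrtCod A x)‖ / ‖sqrtCod A x‖ := by
    intro x
    rw [← h, seminormA_eq_norm hA, seminormA_eq_norm hA]
    rfl
  have hub : ∀ c ∈ {c : ℝ | ∃ ξ : H, ξ ∈ closure (Set.range A) ∧ ξ ≠ 0 ∧
      c = seminormA A (R ξ) / seminormA A ξ}, c ≤ ‖Y‖ := by
    rintro _ ⟨ξ, -, -, rfl⟩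
    rw [hY]
    exact Y.ratio_le_opNorm _
  refine (Real.sSup_le hub (norm_nonneg Y)).antisymm ?_
  have hnonneg : 0 ≤ opNormA A R := by
    apply Real.sSup_nonneg
    rintro _ ⟨ξ, -, -, rfl⟩
    exact div_nonneg (Real.sqrt_nonneg _) (Real.sqrt_nonneg _)
  refine Y.opNorm_le_bound hnonneg fun k => ?_
  refine (denseRange_sqrtCod A).induction_on k
    (isClosed_le (by fun_prop) (by fun_prop)) fun x => ?_
  rcases eq_or_ne (sqrtCod A x) 0 with h0 | h0
  · simp [h0]
  · rw [← div_le_iff₀ (norm_pos_iff.mpr h0)]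
    -- The supremum only sees vectors in the closed range; projecting `x` there leaves `A^{1/2} x`
    -- unchanged.
    refine le_csSup ⟨‖Y‖, hub⟩ ⟨proj A x, ?_, ?_, ?_⟩
    · rw [closure_range_eq hA]
      exact (proj A x).2
    · intro hp
      rw [← sqrtCod_proj, hp, map_zero] at h0
      exact h0 rfl
    · rw [hY, sqrtCod_proj]

theorem sqrtCod_pow_apply {A R : H →L[ℂ] H} {Y : closedRange A →L[ℂ] closedRange A}
    (h : ∀ x, sqrtCod A (R x) = Y (sqrtCod A x)) (n : ℕ) (x : H) :
    sqrtCod A ((R ^ n) x) = (Y ^ n) (sqrtCod A x) := by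
  induction n generalizing x with
  | zero => rfl
  | succ n ih =>
    rw [pow_succ, pow_succ, mul_apply_eq_comp, mul_apply_eq_comp, ih, h]

/-! ### Intertwined pairs and `A`-inverses -/

/-- `A^{1/2}` as an operator on the closure of its range. -/
def sqrtEnd (A : H →L[ℂ] H) : closedRange A →L[ℂ] closedRange A :=
  sqrtCod A ∘L (closedRange A).subtypeL

theorem sqrtCod_intertwiner {A : H →L[ℂ] H} (p : intertwiners (sqrtEnd A)) (k : closedRange A) :
    sqrtCod A (p.1.1 k) = p.1.2 (sqrtCod A k) :=
  congrArg (fun B : closedRange A →L[ℂ] closedRange A => B k) (show sqrtEnd A * p.1.1 = p.1.2 * sqrtEnd A from p.2)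

/-- The pair of compressions of `T` and `S`, when `S A^{1/2} = A^{1/2} T`. -/
def toIntertwiner {A S T : H →L[ℂ] H} (h : S ∘L sqrtA A = sqrtA A ∘L T) :
    intertwiners (sqrtEnd A) :=
  ⟨(compress A T, compress A S), ContinuousLinearMap.ext fun k => by
    change sqrtCod A (compress A T k) = compress A S (sqrtCod A k)
    rw [← sqrtCod_apply_of_intertwine h, compress_apply, sqrtCod_proj]⟩

theorem compress_proj_of_intertwine {A S T : H →L[ℂ] H} (h : S ∘L sqrtA A = sqrtA A ∘L T) (x : H) :
    compress A T (proj A x) = proj A (T x) := by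
  rw [compress_apply]
  apply proj_eq_of_sqrtA_eq
  have h1 : ∀ y, S (sqrtA A y) = sqrtA A (T y) := fun y =>
    congrArg (fun B : H →L[ℂ] H => B y) h
  rw [← h1, ← h1, sqrtA_proj]

/-- A pair of intertwined operators is determined by its first component. -/
theorem intertwiners_ext {A : H →L[ℂ] H} {p q : intertwiners (sqrtEnd A)} (h : p.1.1 = q.1.1) : p = q := by
  refine Subtype.ext (Prod.ext h (ContinuousLinearMap.ext fun k => ?_))
  refine (denseRange_sqrtCod A).induction_on k (isClosed_eq (by fun_prop) (by fun_prop)) fun x => ?_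
  rw [← sqrtCod_proj, ← sqrtCod_intertwiner, ← sqrtCod_intertwiner, h]

theorem toIntertwiner_mul_eq_one {A S T S' T' : H →L[ℂ] H} (hA : A.IsPositive)
    (h : S ∘L sqrtA A = sqrtA A ∘L T) (h' : S' ∘L sqrtA A = sqrtA A ∘L T')
    (hT : A ∘L T ∘L T' = A) : toIntertwiner h * toIntertwiner h' = 1 := by
  refine intertwiners_ext (ContinuousLinearMap.ext fun k => ?_)
  change compress A T (proj A (T' k)) = k
  rw [compress_proj_of_intertwine h, proj_eq_of_sqrtA_eq (y := (k : H)), proj_coe]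
  exact sqrtA_eq_of_apply_eq hA (congrArg (fun B : H →L[ℂ] H => B k) hT)

/-- Every pair of intertwined operators comes from `B_{A^{1/2}}(H)`. -/
theorem exists_toIntertwiner_eq {A : H →L[ℂ] H} (p : intertwiners (sqrtEnd A)) :
    ∃ (S T : H →L[ℂ] H) (h : S ∘L sqrtA A = sqrtA A ∘L T), toIntertwiner h = p := by
  -- Extend both components by zero on the orthogonal complement.
  refine ⟨(closedRange A).subtypeL ∘L p.1.2 ∘L proj A, (closedRange A).subtypeL ∘L p.1.1 ∘L proj A,
    ContinuousLinearMap.ext fun x => ?_, intertwiners_ext (ContinuousLinearMap.ext fun k => ?_)⟩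
  · change ((p.1.2 (proj A (sqrtCod A x)) : closedRange A) : H) = sqrtCod A (p.1.1 (proj A x))
    rw [sqrtCod_intertwiner, proj_coe, sqrtCod_proj]
  · change proj A (p.1.1 (proj A k)) = p.1.1 k
    rw [proj_coe, proj_coe]

theorem comp_eq_of_toIntertwiner_mul_eq_one {A S T S' T' : H →L[ℂ] H} (hA : A.IsPositive)
    {h : S ∘L sqrtA A = sqrtA A ∘L T} {h' : S' ∘L sqrtA A = sqrtA A ∘L T'}
    (hp : toIntertwiner h * toIntertwiner h' = 1) : A ∘L T ∘L T' = A := by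
  refine ContinuousLinearMap.ext fun x => ?_
  have h1 : compress A T (compress A T' (proj A x)) = proj A x :=
    congrArg (fun q : intertwiners (sqrtEnd A) => q.1.1 (proj A x)) hp
  rw [compress_proj_of_intertwine h', compress_proj_of_intertwine h] at h1
  have h2 : sqrtA A (T (T' x)) = sqrtA A x := by
    rw [← sqrtA_proj, h1, sqrtA_proj]
  change A (T (T' x)) = A x
  rw [← sqrtA_sqrtA hA, h2, sqrtA_sqrtA hA]

theorem isInvertibleA_iff_isUnit {A S T : H →L[ℂ] H} (hA : A.IsPositive) (hA0 : A ≠ 0)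
    (h : S ∘L sqrtA A = sqrtA A ∘L T) : IsInvertibleA A T ↔ IsUnit (toIntertwiner h) := by
  constructor
  · rintro ⟨-, -, T', hT', -, h1, h2⟩
    obtain ⟨S', h'⟩ := mem_BHalf_iff.mp hT'
    exact ⟨⟨_, _, toIntertwiner_mul_eq_one hA h h' h1, toIntertwiner_mul_eq_one hA h' h h2⟩, rfl⟩
  · rintro ⟨u, hu⟩
    obtain ⟨S', T', h', hp⟩ := exists_toIntertwiner_eq (↑u⁻¹ : intertwiners (sqrtEnd A))
    have h1 : A ∘L T ∘L T' = A := by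
      apply comp_eq_of_toIntertwiner_mul_eq_one hA (h := h) (h' := h')
      rw [← hu, hp, u.mul_inv]
    have h2 : A ∘L T' ∘L T = A := by
      apply comp_eq_of_toIntertwiner_mul_eq_one hA (h := h') (h' := h)
      rw [← hu, hp, u.inv_mul]
    refine ⟨mem_BHalf_iff.mpr ⟨S, h⟩, ?_, T', mem_BHalf_iff.mpr ⟨S', h'⟩, ?_, h1, h2⟩
    · rintro rfl
      exact hA0 (by simpa using h1.symm)
    · rintro rfl
      exact hA0 (by simpa using h1.symm)

/-! ### The `A`-spectrum and the `A`-spectral radius -/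

theorem spectrumA_eq_spectrum {A S T : H →L[ℂ] H} (hA : A.IsPositive) (hA0 : A ≠ 0)
    (h : S ∘L sqrtA A = sqrtA A ∘L T) : spectrumA A T = spectrum ℂ (toIntertwiner h) := by
  ext μ
  have hμ : (μ • ContinuousLinearMap.id ℂ H - S) ∘L sqrtA A =
      sqrtA A ∘L (μ • ContinuousLinearMap.id ℂ H - T) := by
    rw [ContinuousLinearMap.sub_comp, ContinuousLinearMap.comp_sub, h]
    ext x
    simp
  have he : toIntertwiner hμ = algebraMap ℂ (intertwiners (sqrtEnd A)) μ - toIntertwiner h := by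
    refine intertwiners_ext (ContinuousLinearMap.ext fun k => ?_)
    change proj A (μ • (k : H) - T k) = μ • k - proj A (T k)
    rw [map_sub, map_smul, proj_coe]
  rw [spectrum.mem_iff, ← he, ← isInvertibleA_iff_isUnit hA hA0 hμ]
  rfl

theorem nontrivial_closedRange {A : H →L[ℂ] H} (hA : A.IsPositive) (hA0 : A ≠ 0) :
    Nontrivial (closedRange A) := by
  obtain ⟨x, hx⟩ : ∃ x, A x ≠ 0 := by
    by_contra! h
    exact hA0 (ContinuousLinearMap.ext h)
  rw [Submodule.nontrivial_iff_ne_bot, Submodule.ne_bot_iff]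
  exact ⟨sqrtA A (sqrtA A x), sqrtA_mem_closedRange A _, by rwa [sqrtA_sqrtA hA]⟩

/-- The radius is governed by `S`, not `R`, because `‖R x‖_A = ‖A^{1/2} R x‖ = ‖S A^{1/2} x‖`. -/
theorem tendsto_rootSeqA {A S R : H →L[ℂ] H} (hA : A.IsPositive) [Nontrivial (closedRange A)]
    (h : S ∘L sqrtA A = sqrtA A ∘L R) :
    Tendsto (rootSeqA A R) atTop (𝓝 (realSpectralRadius (compress A S))) := by
  refine (tendsto_realSpectralRadius (compress A S)).congr fun n => ?_
  rw [rootSeqA, opNormA_eq_norm hA (sqrtCod_pow_apply (sqrtCod_apply_of_intertwine h) n)]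

theorem isGreatest_norm_spectrumA {A S T : H →L[ℂ] H} (hA : A.IsPositive) (hA0 : A ≠ 0)
    [Nontrivial (closedRange A)] (h : S ∘L sqrtA A = sqrtA A ∘L T) :
    IsGreatest {r : ℝ | ∃ μ ∈ spectrumA A T, r = ‖μ‖}
      (max (realSpectralRadius (compress A T)) (realSpectralRadius (compress A S))) := by
  rw [spectrumA_eq_spectrum hA hA0 h]
  exact isGreatest_norm_spectrum_intertwiners (toIntertwiner h)

theorem realSpectralRadius_adjoint {K : Type*} [NormedAddCommGroup K] [InnerProductSpace ℂ K]
    [CompleteSpace K] [Nontrivial K] (X : K →L[ℂ] K) :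
    realSpectralRadius (ContinuousLinearMap.adjoint X) = realSpectralRadius X := by
  refine tendsto_nhds_unique (tendsto_realSpectralRadius _)
    ((tendsto_realSpectralRadius X).congr fun n => ?_)
  rw [← ContinuousLinearMap.star_eq_adjoint, ← star_pow, norm_star]

end SemiHilbert

end

open SemiHilbert in
theorem mainTheorem1 {H : Type*} [NormedAddCommGroup H] [InnerProductSpace ℂ H] [CompleteSpace H]
    (A : H →L[ℂ] H) (hA : A.IsPositive) (hA0 : A ≠ 0)
    (T : H →L[ℂ] H) (hT : T ∈ BHalf A) :
    Filter.Tendsto (rootSeqA A T) Filter.atTop (nhds (spectralRadiusA A T)) ∧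
    diamond hT ∈ BHalf A ∧
    Filter.Tendsto (rootSeqA A (diamond hT)) Filter.atTop
      (nhds (spectralRadiusA A (diamond hT))) ∧
    IsLUB {r : ℝ | ∃ μ ∈ spectrumA A T, r = ‖μ‖}
      ((spectralRadiusA A T + spectralRadiusA A (diamond hT) +
        |spectralRadiusA A (diamond hT) - spectralRadiusA A T|) / 2) ∧
    (spectralRadiusA A T + spectralRadiusA A (diamond hT) +
        |spectralRadiusA A (diamond hT) - spectralRadiusA A T|) / 2 =
      max (spectralRadiusA A T) (spectralRadiusA A (diamond hT)) := by
  have := nontrivial_closedRange hA hA0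
  have hD := (diamond_spec hT).1
  obtain ⟨S, hS⟩ := mem_BHalf_iff.mp hT
  have hlimT := tendsto_rootSeqA hA hS
  -- For `T^◇` the intertwining operator is `T*`; passing to the adjoint turns the limit into the
  -- spectral radius of the compression of `T`.
  have hlimD := tendsto_rootSeqA hA hD
  rw [← adjoint_compress, realSpectralRadius_adjoint] at hlimD
  have hmax : ∀ a b : ℝ, (a + b + |b - a|) / 2 = max a b := fun a b => by
    rcases le_total a b with h | h
    · rw [max_eq_right h, abs_of_nonneg (sub_nonneg.mpr h)]
      ring
    · rw [max_eq_left h, abs_of_nonpos (sub_nonpos.mpr h)]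
      ring
  refine ⟨tendsto_nhds_limUnder ⟨_, hlimT⟩, mem_BHalf_iff.mpr ⟨_, hD⟩,
    tendsto_nhds_limUnder ⟨_, hlimD⟩, ?_, hmax _ _⟩
  rw [hmax, spectralRadiusA, spectralRadiusA, hlimT.limUnder_eq, hlimD.limUnder_eq, max_comm]
  exact (isGreatest_norm_spectrumA hA hA0 hS).isLUB
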